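/- Let $\mathcal A$ be a small category and let $M:\mathcal A^{op}\times\mathcal A\to\mathsf{Set}$ be a module on $\mathcal A$. An element $m\in M(a,b)$ is written as a broken arrow $m:a\nrightarrow b$; for $f:a'\to a$ and $g:b\to b'$ put $m@f=M(f,b)(m)$ and $g@m=M(a,g)(m)$. A functor $X:\mathcal A\to\mathsf{Set}$ is *flat* if its category of elements is cofiltered; $\mathrm{Flat}(\mathcal A)$ is the category of flat functors and all natural transformations. Assume that $M$ is *flat*, i.e. every $M(a,-)$ is flat. Then $X\mapsto M\otimes X$, $(M\otimes X)(a)=\int^{b}M(b,a)\times X(b)$, is an endofunctor of $\mathrm{Flat}(\mathcal A)$. A *final coalgebra* for it is a terminal object of its category of coalgebras. The category $\mathrm{Complex}(M)$ has as objects the infinite chains $\cdots\overset{m_3}{\nrightarrow} a_2\overset{m_2}{\nrightarrow}a_1\overset{m_1}{\nrightarrow}a_0$ and as morphisms $(a_\bullet,m_\bullet)\to(a'_\bullet,m'_\bullet)$ the sequences $f_n:a_n\to a_n'$ with $m'_{n+1}@f_{n+1}=f_n@m_{n+1}$ for all $n\ge 0$. The category $\mathrm{Complex}_n(M)$ of finite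 chains $a_n\nrightarrow\cdots\nrightarrow a_0$ is defined in the same way, $\mathrm{pr}_n:\mathrm{Complex}(M)\to\mathrm{Complex}_n(M)$ is truncation, and $\mathrm{Complex}_0(M)=\mathcal A$. $M$ is *pointed* if it is equipped with a natural transformation $\mathcal A(-,-)\to M$. $M$ is *compact* if for every $n\ge 0$ and every functor $D:\mathcal D\to\mathrm{Complex}(M)$ with $\mathcal D$ a finite nonempty category, the preorder of cones for $\mathrm{pr}_n\cdot D$ (where $c\sqsubseteq c'$ iff $c$ factors through $c'$) has a finite subset $S$ such that every cone is $\sqsubseteq$ some member of $S$ (so $S$ is nonempty whenever there is a cone). Suppose that $M$ is a flat, pointed, compact module on $\mathcal A$. Then the following are equivalent: 1. (Weak Solvability Condition) The functor $\mathrm{pr}_0:\mathrm{Complex}(M)\to\mathcal A$ is cofiltering, i.e. for every functor $D:\mathcal D\to\mathrm{Complex}(M)$ with $\mathcal D$ a finite category there is a cone for $\mathrm{pr}_0\cdot D$. 2. (Strong Solvability Condition) The category $\mathrm{Complex}(M)$ is cofiltered. 3. The colimit of the diagram $\mathrm{Complex}(M)^{op}\xrightarrow{\mathrm{pr}_0^{op}}\mathcal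 A^{op}\xrightarrow{Y}[\mathcal A,\mathsf{Set}]$ of representables, where $Y(a)=\mathcal A(a,-)$, is a flat functor. 4. A final coalgebra for $M\otimes-:\mathrm{Flat}(\mathcal A)\to\mathrm{Flat}(\mathcal A)$ exists. -/

import Mathlib

open CategoryTheory CategoryTheory.Limits Opposite

universe u

namespace SelfSimilarity

noncomputable section

/-! ### Flat functors -/

section Flat

variable {A : Type u} [SmallCategory A]

/-- A functor `X : A ⥤ Type u` is flat if its category of elements is cofiltered. -/
def IsFlat : ObjectProperty (A ⥤ Type u) :=
  fun X => IsCofiltered X.Elements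

variable (A) in
/-- The category of flat functors `A ⥤ Type u` and all natural transformations between them. -/
abbrev Flat := (IsFlat (A := A)).FullSubcategory

end Flat

/-! ### Modules -/

/-- A module on `A` is a functor of two variables on `A`, contravariant in the first one and
covariant in the second one, with values in sets; it is given here in curried form. The elements
of `(M.obj (op a)).obj b` are the broken arrows from `a` to `b`. -/
abbrev CatModule (A : Type u) [SmallCategory A] := Aᵒᵖ ⥤ A ⥤ Type u

variable {A : Type u} [SmallCategory A]

variable (A) in
/-- The identity module, sending `(a, b)` to the set of morphisms from `a` to `b`. -/
abbrev idModule : CatModule A := coyoneda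

/-- A module is flat if `M(a, -)` is a flat functor for every object `a`. -/
def IsFlatModule (M : CatModule A) : Prop :=
  ∀ a : A, IsFlat (M.obj (op a))

/-- The set `M(a, b)` of broken arrows from `a` to `b`. -/
abbrev Broken (M : CatModule A) (a b : A) : Type u := (M.obj (op a)).obj b

/-- The contravariant action: `m @ f`, for `f : a' ⟶ a` and `m` in `M(a, b)`. -/
abbrev actL (M : CatModule A) {a' a b : A} (m : Broken M a b) (f : a' ⟶ a) : Broken M a' b :=
  (M.map f.op).app b m

/-- The covariant action: `g @ m`, for `m` in `M(a, b)` and `g : b ⟶ b'`. -/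
abbrev actR (M : CatModule A) {a b b' : A} (g : b ⟶ b') (m : Broken M a b) : Broken M a b' :=
  (M.obj (op a)).map g m

lemma actL_comp (M : CatModule A) {a a' a'' b : A} (m : Broken M a b) (f : a' ⟶ a)
    (g : a'' ⟶ a') : actL M m (g ≫ f) = actL M (actL M m f) g := by
  simp [actL]

lemma actL_id (M : CatModule A) {a b : A} (m : Broken M a b) : actL M m (𝟙 a) = m := by
  simp [actL]

lemma actR_actL (M : CatModule A) {a a' b b' : A} (g : b ⟶ b') (m : Broken M a b)
    (f : a' ⟶ a) : actR M g (actL M m f) = actL M (actR M g m) f :=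
  ((M.map f.op).naturality_apply g m).symm

/-! ### The endofunctor `M ⊗ -` -/

/-- Pairs `(m, x)` in the disjoint union of the sets `M(b, a) × X b`. -/
abbrev TensorPair (M : CatModule A) (X : A ⥤ Type u) (a : A) : Type u :=
  Σ b : A, Broken M b a × X.obj b

/-- The generating relation of the coend of `M(b, a) × X b`: `(m @ f, x)` is identified with
`(m, X f x)`. -/
inductive TensorRel (M : CatModule A) (X : A ⥤ Type u) (a : A) :
    TensorPair M X a → TensorPair M X a → Prop
  | glue {b b' : A} (f : b ⟶ b') (m : Broken M b' a) (x : X.obj b) :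
      TensorRel M X a ⟨b, actL M m f, x⟩ ⟨b', m, X.map f x⟩

/-- `(M ⊗ X)(a)`, the coend of `M(b, a) × X b` over `b`: the quotient by the equivalence relation
generated by `TensorRel`. -/
def TensorObj (M : CatModule A) (X : A ⥤ Type u) (a : A) : Type u :=
  Quot (TensorRel M X a)

/-- The element `m ⊗ x` of `(M ⊗ X)(a)`. -/
def tmk (M : CatModule A) (X : A ⥤ Type u) {a b : A} (m : Broken M b a) (x : X.obj b) :
    TensorObj M X a :=
  Quot.mk _ ⟨b, m, x⟩

lemma tmk_glue (M : CatModule A) (X : A ⥤ Type u) {a b b' : A} (f : b ⟶ b')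
    (m : Broken M b' a) (x : X.obj b) :
    tmk M X (actL M m f) x = tmk M X m (X.map f x) :=
  Quot.sound (TensorRel.glue f m x)

/-- The covariant action of `A` on `M ⊗ X`: `g @ (m ⊗ x) = (g @ m) ⊗ x`. -/
def tensorAct (M : CatModule A) (X : A ⥤ Type u) {a a' : A} (g : a ⟶ a') :
    TensorObj M X a → TensorObj M X a' :=
  Quot.lift (fun p => tmk M X (actR M g p.2.1) p.2.2) (by
    rintro _ _ ⟨f, m, x⟩
    simp only [actR_actL, tmk_glue])

/-- The functor `M ⊗ X : A ⥤ Type u`. -/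
def tensorObj (M : CatModule A) (X : A ⥤ Type u) : A ⥤ Type u where
  obj a := TensorObj M X a
  map g := ↾(tensorAct M X g)
  map_id a := by
    ext t
    induction t using Quot.ind with
    | mk p =>
      change tmk M X (actR M (𝟙 a) p.2.1) p.2.2 = tmk M X p.2.1 p.2.2
      rw [actR, Functor.map_id_apply]
  map_comp g h := by
    ext t
    induction t using Quot.ind with
    | mk p =>
      change tmk M X (actR M (g ≫ h) p.2.1) p.2.2 = tmk M X (actR M h (actR M g p.2.1)) p.2.2
      rw [actR, Functor.map_comp_apply]

lemma tensorObj_map_tmk (M : CatModule A) (X : A ⥤ Type u) {a a' b : A} (g : a ⟶ a')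
    (m : Broken M b a) (x : X.obj b) :
    (tensorObj M X).map g (tmk M X m x) = tmk M X (actR M g m) x :=
  rfl

/-- The natural transformation `M ⊗ h`, given by `m ⊗ x ↦ m ⊗ h x`. -/
def tensorMap (M : CatModule A) {X Y : A ⥤ Type u} (h : X ⟶ Y) :
    tensorObj M X ⟶ tensorObj M Y where
  app a := ↾(Quot.lift (fun p => tmk M Y p.2.1 (h.app p.1 p.2.2)) (by
    rintro _ _ ⟨f, m, x⟩
    simp only [tmk_glue, NatTrans.naturality_apply]) : TensorObj M X a → TensorObj M Y a)
  naturality a a' g := by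
    ext t
    induction t using Quot.ind with
    | mk p => rfl

lemma tensorMap_app_tmk (M : CatModule A) {X Y : A ⥤ Type u} (h : X ⟶ Y) {a b : A}
    (m : Broken M b a) (x : X.obj b) :
    (tensorMap M h).app a (tmk M X m x) = tmk M Y m (h.app b x) :=
  rfl

/-- For flat `X`, two equal elements of `M ⊗ X` are identified by a span. -/
lemma exists_span_of_tmk_eq (M : CatModule A) {X : A ⥤ Type u} (hX : IsFlat X) {a b b' : A}
    {m : Broken M b a} {x : X.obj b} {m' : Broken M b' a} {x' : X.obj b'}
    (h : tmk M X m x = tmk M X m' x') :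
    ∃ (d : A) (z : X.obj d) (f : d ⟶ b) (f' : d ⟶ b'),
      X.map f z = x ∧ X.map f' z = x' ∧ actL M m f = actL M m' f' := by
  have : IsCofiltered X.Elements := hX
  have key : ∀ p q : TensorPair M X a, Relation.EqvGen (TensorRel M X a) p q →
      ∃ (d : A) (z : X.obj d) (f : d ⟶ p.1) (f' : d ⟶ q.1),
        X.map f z = p.2.2 ∧ X.map f' z = q.2.2 ∧ actL M p.2.1 f = actL M q.2.1 f' := by
    intro p q hpq
    induction hpq with
    | rel p q hr =>
      obtain ⟨f, m, x⟩ := hr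
      exact ⟨_, x, 𝟙 _, f, by simp, rfl, by simp only [actL_id]⟩
    | refl p => exact ⟨p.1, p.2.2, 𝟙 _, 𝟙 _, by simp, by simp, rfl⟩
    | symm p q _ ih =>
      obtain ⟨d, z, f, f', h1, h2, h3⟩ := ih
      exact ⟨d, z, f', f, h2, h1, h3.symm⟩
    | trans p q r _ _ ih1 ih2 =>
      obtain ⟨d, z, f, f', h1, h2, h3⟩ := ih1
      obtain ⟨e, w, g, g', k1, k2, k3⟩ := ih2
      obtain ⟨v, s, t, hst⟩ := IsCofiltered.cospan
        (CategoryOfElements.homMk (X.elementsMk d z) (X.elementsMk q.1 q.2.2) f' h2)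
        (CategoryOfElements.homMk (X.elementsMk e w) (X.elementsMk q.1 q.2.2) g k1)
      have hst' : s.1 ≫ f' = t.1 ≫ g := congrArg Subtype.val hst
      have hs : X.map s.1 v.2 = z := s.2
      have ht : X.map t.1 v.2 = w := t.2
      refine ⟨v.1, v.2, s.1 ≫ f, t.1 ≫ g', ?_, ?_, ?_⟩
      · rw [Functor.map_comp_apply, hs, h1]
      · rw [Functor.map_comp_apply, ht, k2]
      · rw [actL_comp, h3, ← actL_comp, hst', actL_comp, k3, ← actL_comp]
  exact key ⟨b, m, x⟩ ⟨b', m', x'⟩ (Quot.eqvGen_exact h)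

/-- If `M` and `X` are flat, then so is `M ⊗ X`. -/
lemma isFlat_tensorObj (M : CatModule A) (hM : IsFlatModule M) {X : A ⥤ Type u}
    (hX : IsFlat X) : IsFlat (tensorObj M X) := by
  have hXc : IsCofiltered X.Elements := hX
  have hMc : ∀ a : A, IsCofiltered (M.obj (op a)).Elements := hM
  have hne : Nonempty (tensorObj M X).Elements := by
    obtain ⟨b, x⟩ := hXc.nonempty
    obtain ⟨a, m⟩ := (hMc b).nonempty
    exact ⟨⟨a, tmk M X m x⟩⟩
  refine @IsCofiltered.mk _ _ ⟨?_, ?_⟩ hne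
  · rintro ⟨a₁, t₁⟩ ⟨a₂, t₂⟩
    obtain ⟨⟨b₁, m₁, x₁⟩, rfl⟩ := Quot.exists_rep t₁
    obtain ⟨⟨b₂, m₂, x₂⟩, rfl⟩ := Quot.exists_rep t₂
    obtain ⟨⟨d, z⟩, ⟨f₁, hf₁⟩, ⟨f₂, hf₂⟩, -⟩ :=
      hXc.cone_objs (X.elementsMk b₁ x₁) (X.elementsMk b₂ x₂)
    obtain ⟨⟨a, m⟩, ⟨g₁, hg₁⟩, ⟨g₂, hg₂⟩, -⟩ :=
      (hMc d).cone_objs ((M.obj (op d)).elementsMk a₁ (actL M m₁ f₁))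
        ((M.obj (op d)).elementsMk a₂ (actL M m₂ f₂))
    refine ⟨⟨a, tmk M X m z⟩, ⟨g₁, ?_⟩, ⟨g₂, ?_⟩, trivial⟩
    · refine (tensorObj_map_tmk M X g₁ m z).trans ?_
      refine (congrArg (fun n => tmk M X n z) hg₁).trans ?_
      exact (tmk_glue M X f₁ m₁ z).trans (congrArg (tmk M X m₁) hf₁)
    · refine (tensorObj_map_tmk M X g₂ m z).trans ?_
      refine (congrArg (fun n => tmk M X n z) hg₂).trans ?_
      exact (tmk_glue M X f₂ m₂ z).trans (congrArg (tmk M X m₂) hf₂)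
  · rintro ⟨a₁, t₁⟩ ⟨a₂, t₂⟩ ⟨p, hp⟩ ⟨q, hq⟩
    obtain ⟨⟨b, m, x⟩, rfl⟩ := Quot.exists_rep t₁
    have hpq : tmk M X (actR M p m) x = tmk M X (actR M q m) x := hp.trans hq.symm
    obtain ⟨d, z, f, f', h1, h2, h3⟩ := exists_span_of_tmk_eq M hX hpq
    obtain ⟨⟨e, w⟩, ⟨k, hk⟩, hkk⟩ := hXc.cone_maps
      (X := X.elementsMk d z) (Y := X.elementsMk b x) ⟨f, h1⟩ ⟨f', h2⟩
    have hkk' : k ≫ f = k ≫ f' := congrArg Subtype.val hkk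
    have hk' : X.map k w = z := hk
    have hn : actR M p (actL M m (k ≫ f)) = actR M q (actL M m (k ≫ f)) := by
      rw [actR_actL, actL_comp, h3, ← actL_comp, ← hkk', ← actR_actL]
    obtain ⟨⟨a, n⟩, ⟨g, hg⟩, hgg⟩ := (hMc e).cone_maps
      (X := (M.obj (op e)).elementsMk a₁ (actL M m (k ≫ f)))
      (Y := (M.obj (op e)).elementsMk a₂ (actR M q (actL M m (k ≫ f)))) ⟨p, hn⟩ ⟨q, rfl⟩
    have hgg' : g ≫ p = g ≫ q := congrArg Subtype.val hgg
    refine ⟨⟨a, tmk M X n w⟩, ⟨g, ?_⟩, Subtype.ext hgg'⟩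
    refine (tensorObj_map_tmk M X g n w).trans ?_
    refine (congrArg (fun r => tmk M X r w) hg).trans ?_
    refine (tmk_glue M X (k ≫ f) m w).trans (congrArg (tmk M X m) ?_)
    rw [Functor.map_comp_apply, hk', h1]

/-- The endofunctor `M ⊗ -` of the category of flat functors, for a flat module `M`. -/
def tensorFlat (M : CatModule A) (hM : IsFlatModule M) : Flat A ⥤ Flat A where
  obj X := ⟨tensorObj M X.obj, isFlat_tensorObj M hM X.property⟩
  map h := ObjectProperty.homMk (tensorMap M h.hom)
  map_id X := by
    ext a t
    induction t using Quot.ind with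
    | mk p => rfl
  map_comp g h := by
    ext a t
    induction t using Quot.ind with
    | mk p => rfl

/-- An endofunctor has a final coalgebra if its category of coalgebras has a terminal object. -/
def HasFinalCoalgebra {K : Type*} [Category* K] (F : K ⥤ K) : Prop :=
  ∃ T : Endofunctor.Coalgebra F, Nonempty (IsTerminal T)

/-! ### Complexes -/

/-- An `M`-complex: an infinite chain `⋯ ⇸ a₂ ⇸ a₁ ⇸ a₀` of broken arrows. -/
structure Complex (M : CatModule A) : Type u where
  obj : ℕ → A
  arr : ∀ n, Broken M (obj (n + 1)) (obj n)

namespace Complex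

variable {M : CatModule A}

/-- A morphism of complexes: a sequence `fₙ : aₙ ⟶ a'ₙ` making all squares commute. -/
@[ext]
structure Hom (c c' : Complex M) : Type u where
  app : ∀ n, c.obj n ⟶ c'.obj n
  comm : ∀ n, actL M (c'.arr n) (app (n + 1)) = actR M (app n) (c.arr n)

instance : SmallCategory (Complex M) where
  Hom c c' := Hom c c'
  id c := ⟨fun n => 𝟙 (c.obj n), fun n => by simp [actL, actR]⟩
  comp {c c' c''} f g := ⟨fun n => f.app n ≫ g.app n, fun n => by
    rw [actL_comp, g.comm, ← actR_actL, f.comm]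
    simp [actR]⟩
  id_comp f := by apply Hom.ext; funext n; exact Category.id_comp _
  comp_id f := by apply Hom.ext; funext n; exact Category.comp_id _
  assoc f g h := by apply Hom.ext; funext n; exact Category.assoc _ _ _

end Complex

/-- An `n`-truncated `M`-complex: a finite chain `aₙ ⇸ ⋯ ⇸ a₁ ⇸ a₀` of broken arrows. -/
structure TruncComplex (M : CatModule A) (n : ℕ) : Type u where
  obj : Fin (n + 1) → A
  arr : ∀ i : Fin n, Broken M (obj i.succ) (obj i.castSucc)

namespace TruncComplex

variable {M : CatModule A} {n : ℕ}

/-- A morphism of truncated complexes: morphisms `fᵢ : aᵢ ⟶ a'ᵢ` making all squares commute. -/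
@[ext]
structure Hom (c c' : TruncComplex M n) : Type u where
  app : ∀ i, c.obj i ⟶ c'.obj i
  comm : ∀ i : Fin n, actL M (c'.arr i) (app i.succ) = actR M (app i.castSucc) (c.arr i)

instance : SmallCategory (TruncComplex M n) where
  Hom c c' := Hom c c'
  id c := ⟨fun i => 𝟙 (c.obj i), fun i => by simp [actL, actR]⟩
  comp {c c' c''} f g := ⟨fun i => f.app i ≫ g.app i, fun i => by
    rw [actL_comp, g.comm, ← actR_actL, f.comm]
    simp [actR]⟩
  id_comp f := by apply Hom.ext; funext n; exact Category.id_comp _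
  comp_id f := by apply Hom.ext; funext n; exact Category.comp_id _
  assoc f g h := by apply Hom.ext; funext n; exact Category.assoc _ _ _

variable (M n) in
/-- The functor sending a truncated complex to its object `a₀`. For `n = 0` this is the
identification of the category of `0`-truncated complexes with `A`. -/
def head : TruncComplex M n ⥤ A where
  obj c := c.obj 0
  map f := f.app 0
  map_id _ := rfl
  map_comp _ _ := rfl

end TruncComplex

/-- The truncation functor from complexes to `n`-truncated complexes. -/
def pr (M : CatModule A) (n : ℕ) : Complex M ⥤ TruncComplex M n where
  obj c := ⟨fun i => c.obj i, fun i => c.arr i⟩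
  map f := ⟨fun i => f.app i, fun i => f.comm i⟩
  map_id _ := rfl
  map_comp _ _ := rfl

/-- The truncation functor `pr₀`, regarded as a functor to `A`; it sends a complex to `a₀`. -/
def prHead (M : CatModule A) : Complex M ⥤ A := pr M 0 ⋙ TruncComplex.head M 0

/-! ### Solvability conditions and compactness -/

/-- A functor `F` is cofiltering if the composite `D ⋙ F` has a cone, for every functor `D` from
a finite category to the domain of `F`. -/
def IsCofiltering {X Y : Type*} [Category* X] [Category* Y] (F : X ⥤ Y) : Prop :=
  ∀ (J : Type) [SmallCategory J] [FinCategory J] (D : J ⥤ X), Nonempty (Cone (D ⋙ F))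

/-- The Weak Solvability Condition: the functor `pr₀` is cofiltering. -/
def WeakSolvability (M : CatModule A) : Prop := IsCofiltering (pr M 0)

/-- The Strong Solvability Condition: the category of complexes is cofiltered. -/
def StrongSolvability (M : CatModule A) : Prop := IsCofiltered (Complex M)

/-- The diagram of representables `A(a₀, -)` indexed by the opposite of the category of complexes. -/
def representables (M : CatModule A) : (Complex M)ᵒᵖ ⥤ A ⥤ Type u := (prHead M).op ⋙ coyoneda

/-- The cones of the `n`-th truncation of the diagram `D`, preordered by: `c ⊑ c'` if and only if
`c` factors through `c'`. -/
def ConePreorder {M : CatModule A} {J : Type} [SmallCategory J] (D : J ⥤ Complex M) (n : ℕ) :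
    Type u :=
  Cone (D ⋙ pr M n)

instance {M : CatModule A} {J : Type} [SmallCategory J] (D : J ⥤ Complex M) (n : ℕ) :
    Preorder (ConePreorder D n) where
  le c c' := ∃ h : Cone.pt c ⟶ Cone.pt c', ∀ j, h ≫ (Cone.π c').app j = (Cone.π c).app j
  le_refl c := ⟨𝟙 _, fun _ => Category.id_comp _⟩
  le_trans c c' c'' := by
    rintro ⟨h, hh⟩ ⟨k, hk⟩
    exact ⟨h ≫ k, fun j => by rw [Category.assoc, hk, hh]⟩

/-- A subset `S` of a preorder is final if every element lies below some element of `S`. -/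
def IsFinalSubset {P : Type*} [Preorder P] (S : Set P) : Prop :=
  ∀ x, ∃ s ∈ S, x ≤ s

/-- A module is compact if, for every finite nonempty diagram `D` of complexes and every `n`, the
preorder of cones of the `n`-th truncation of `D` has a finite final subset. A final subset of a
nonempty preorder is nonempty. It is not required here that the preorder of cones be nonempty:
with this requirement the condition would be a stronger one, see `IsCompactModule.of_nonempty`. -/
def IsCompactModule (M : CatModule A) : Prop :=
  ∀ (n : ℕ) (J : Type) [SmallCategory J] [FinCategory J] [Nonempty J] (D : J ⥤ Complex M),
    ∃ S : Set (ConePreorder D n), S.Finite ∧ IsFinalSubset S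

/-- The variant of compactness that asks for a nonempty finite final subset (and hence for a cone
of every finite nonempty diagram) implies compactness. -/
theorem IsCompactModule.of_nonempty (M : CatModule A)
    (h : ∀ (n : ℕ) (J : Type) [SmallCategory J] [FinCategory J] [Nonempty J]
      (D : J ⥤ Complex M),
      ∃ S : Set (ConePreorder D n), S.Nonempty ∧ S.Finite ∧ IsFinalSubset S) :
    IsCompactModule M := fun n J _ _ _ D =>
  let ⟨S, _, hS⟩ := h n J D
  ⟨S, hS⟩

end

end SelfSimilarity

namespace SelfSimilarity

noncomputable section

variable {A : Type u} [SmallCategory A] {M : CatModule A}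

/-! ### From weak to strong solvability -/

/-! From 1 to 2. Weak solvability gives cones only at the level of the objects `a₀`; flatness lifts
them to every truncation. Indeed, a cone over truncated tails with vertex starting at `b₀` restricts
the last arrows of the diagram to elements of `M(b₀, -)`, and a cone over these elements supplies
one more arrow (`WeakSolvability.nonempty_cone`). Compactness confines the choice at each level to a
finite set, so König's lemma selects a sequence of cones, compatible up to comparison maps, whose
diagonal is a cone of infinite complexes (`nonempty_cone_of_sequence`). From 2 to 3, the diagram is
a filtered one of flat functors, and these are closed under filtered colimits. From 3 to 4, the
colimit `I` itself is the final coalgebra, with `[c] ↦ m₁ ⊗ [tail of c]`. Unfolding an element of a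
coalgebra `X` forever yields a complex, called a resolution. When `X` is flat, any two resolutions
of an element are joined by a span of complexes (`Resolution.exists_span`), so their common class
defines a map `X ⟶ I`. Flatness of `I` makes the class of any resolution of an element of `I` equal
to that element, which forces uniqueness. From 4 to 1, the point makes every flat functor a
coalgebra, in particular each representable. The maps to the final coalgebra `T` then form a cocone,
that is, a functor from `A` to the cofiltered category of elements of `T`. Hence `A` is cofiltered,
which is more than weak solvability needs. -/

lemma actR_comp (M : CatModule A) {a b b' b'' : A} (g : b ⟶ b') (g' : b' ⟶ b'')
    (m : Broken M a b) : actR M (g ≫ g') m = actR M g' (actR M g m) :=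
  Functor.map_comp_apply ..

lemma actR_id (M : CatModule A) {a b : A} (m : Broken M a b) : actR M (𝟙 b) m = m :=
  Functor.map_id_apply ..

namespace Complex

/-- The complex obtained by removing the last arrow `a₁ ⇸ a₀`. -/
def tail (c : Complex M) : Complex M where
  obj n := c.obj (n + 1)
  arr n := c.arr (n + 1)

/-- Removing the last arrow, as a functor. -/
def tailFunctor (M : CatModule A) : Complex M ⥤ Complex M where
  obj c := c.tail
  map f := ⟨fun n => f.app (n + 1), fun n => f.comm (n + 1)⟩
  map_id _ := rfl
  map_comp _ _ := rfl

end Complex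

namespace TruncComplex

/-- Forgetting the first arrow `aₙ₊₁ ⇸ aₙ` of a truncated complex. -/
def truncate (M : CatModule A) (n : ℕ) : TruncComplex M (n + 1) ⥤ TruncComplex M n where
  obj c := ⟨fun i => c.obj i.castSucc, fun i => c.arr i.castSucc⟩
  map f := ⟨fun i => f.app i.castSucc, fun i => f.comm i.castSucc⟩
  map_id _ := rfl
  map_comp _ _ := rfl

/-- Adding a last arrow `a₀ ⇸ b` to a truncated complex. -/
def cons {n : ℕ} (c : TruncComplex M n) (b : A) (m : Broken M (c.obj 0) b) :
    TruncComplex M (n + 1) where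
  obj := Fin.cases b c.obj
  arr := Fin.cases m c.arr

/-- Morphisms from a truncated complex with an arrow added. -/
def consHom {n : ℕ} {c : TruncComplex M n} {b : A} {m : Broken M (c.obj 0) b} {d : Complex M}
    (g : b ⟶ d.obj 0) (f : c ⟶ (pr M n).obj d.tail)
    (h : actR M g m = actL M (d.arr 0) (f.app 0)) : c.cons b m ⟶ (pr M (n + 1)).obj d :=
  { app := Fin.cases (motive := fun i => (c.cons b m).obj i ⟶ d.obj i) g f.app
    comm := Fin.cases h.symm f.comm : Hom (c.cons b m) ((pr M (n + 1)).obj d) }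

end TruncComplex

/-! ### Cones over truncated diagrams and their extension by one arrow. -/

section Cones

variable {J : Type} [SmallCategory J] (D : J ⥤ Complex M)

/-- The truncation of a cone over the `(n + 1)`-st truncation of a diagram of complexes. -/
def truncCone (n : ℕ) (s : Cone (D ⋙ pr M (n + 1))) : ConePreorder D n :=
  { pt := (TruncComplex.truncate M n).obj s.pt
    π :=
      { app := fun j => (TruncComplex.truncate M n).map (s.π.app j)
        naturality := fun _ _ f =>
          congrArg (TruncComplex.truncate M n).map (s.π.naturality f) } : Cone (D ⋙ pr M n) }

lemma cone_w_app {n : ℕ} (s : Cone (D ⋙ pr M n)) {j k : J} (f : j ⟶ k) (i : Fin (n + 1)) :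
    (s.π.app j).app i ≫ (D.map f).app i = (s.π.app k).app i :=
  congrArg (fun h : s.pt ⟶ (D ⋙ pr M n).obj k => TruncComplex.Hom.app h i) (s.w f)

/-- The diagram in the category of elements of `M(a₀, -)` determined by a cone over a truncation
of the tails of a diagram of complexes. -/
def elementsDiagram {n : ℕ} (s : Cone ((D ⋙ Complex.tailFunctor M) ⋙ pr M n)) :
    J ⥤ (M.obj (op (s.pt.obj 0))).Elements where
  obj j := ⟨(D.obj j).obj 0, actL M ((D.obj j).arr 0) ((s.π.app j).app 0)⟩
  map {j k} f := ⟨(D.map f).app 0, by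
    refine (actR_actL M ((D.map f).app 0) ((D.obj j).arr 0) ((s.π.app j).app 0)).trans ?_
    refine (congrArg (actL M · ((s.π.app j).app 0)) ((D.map f).comm 0).symm).trans ?_
    refine (actL_comp M ((D.obj k).arr 0) ((D.map f).app 1) ((s.π.app j).app 0)).symm.trans ?_
    exact congrArg (actL M ((D.obj k).arr 0)) (cone_w_app (D ⋙ Complex.tailFunctor M) s f 0)⟩
  map_id j := Subtype.ext (congrArg (fun h => Complex.Hom.app h 0) (D.map_id j))
  map_comp f g := Subtype.ext (congrArg (fun h => Complex.Hom.app h 0) (D.map_comp f g))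

/-- A cone over the tails, together with a cone over the diagram of its elements, gives a cone with
one more arrow. -/
def consCone {n : ℕ} (s : Cone ((D ⋙ Complex.tailFunctor M) ⋙ pr M n))
    (t : Cone (elementsDiagram D s)) : Cone (D ⋙ pr M (n + 1)) where
  pt := s.pt.cons t.pt.1 t.pt.2
  π :=
    { app := fun j => 
        let g : t.pt ⟶ (elementsDiagram D s).obj j := t.π.app j
        TruncComplex.consHom (d := D.obj j) g.1 (s.π.app j) g.2
      naturality := fun j k f => by
        refine (Category.id_comp _).trans ?_
        apply TruncComplex.Hom.ext
        funext i
        refine Fin.cases ?_ (fun i => ?_) i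
        · exact (congrArg Subtype.val (t.w f)).symm
        · exact (cone_w_app (D ⋙ Complex.tailFunctor M) s f i).symm }

end Cones

lemma WeakSolvability.nonempty_cone (hM : IsFlatModule M) (h : WeakSolvability M) (n : ℕ)
    {J : Type} [SmallCategory J] [FinCategory J] (D : J ⥤ Complex M) :
    Nonempty (Cone (D ⋙ pr M n)) := by
  induction n generalizing J with
  | zero => exact h J D
  | succ n ih =>
    -- The new arrow is attached at the `a₀` end, so the induction hypothesis is needed for the
    -- diagram of tails rather than for `D`.
    obtain ⟨s⟩ := ih (D ⋙ Complex.tailFunctor M)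
    have : IsCofiltered (M.obj (op (s.pt.obj 0))).Elements := hM _
    obtain ⟨t⟩ := IsCofiltered.cone_nonempty (elementsDiagram D s)
    exact ⟨consCone D s t⟩

/-- A sequence of cones over the truncations of a diagram of complexes, such that the truncation of each maps to the
preceding one, yields a cone over the diagram. -/
lemma nonempty_cone_of_sequence {J : Type} [SmallCategory J] (D : J ⥤ Complex M)
    (s : ∀ n, Cone (D ⋙ pr M n))
    (h : ∀ n, truncCone D n (s (n + 1)) ≤ (show ConePreorder D n from s n)) :
    Nonempty (Cone D) := by
  choose h hh using h
  have key : ∀ n j, (h n).app (Fin.last n) ≫ ((s n).π.app j).app (Fin.last n) =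
      ((s (n + 1)).π.app j).app (Fin.last n).castSucc := fun n j =>
    congrArg (fun k : (TruncComplex.truncate M n).obj (s (n + 1)).pt ⟶ (D ⋙ pr M n).obj j =>
      TruncComplex.Hom.app k (Fin.last n)) (hh n j)
  refine ⟨
    -- Diagonal: the `n`-th object is the first object of the `n`-th chain. The first arrow of the
    -- next chain ends at that chain's own `n`-th object, and the comparison map `h n` carries it
    -- over.
    { pt := ⟨fun n => (s n).pt.obj (Fin.last n), fun n =>
        actR M ((h n).app (Fin.last n)) ((s (n + 1)).pt.arr (Fin.last n))⟩
      π :=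
        { app := fun j => ⟨fun n => ((s n).π.app j).app (Fin.last n), fun n => ?_⟩
          naturality := fun j k f => ?_ } }⟩
  · refine (((s (n + 1)).π.app j).comm (Fin.last n)).trans ?_
    refine (congrArg (fun g => actR M g ((s (n + 1)).pt.arr (Fin.last n))) (key n j).symm).trans ?_
    exact actR_comp M ((h n).app (Fin.last n)) (((s n).π.app j).app (Fin.last n)) _
  · refine (Category.id_comp _).trans ?_
    apply Complex.Hom.ext
    funext n
    exact (cone_w_app D (s n) f (Fin.last n)).symm

/-- König's lemma for a sequence of finite nonempty sets. -/
lemma exists_coherent_sequence {S : ℕ → Type u} [∀ n, Finite (S n)] [∀ n, Nonempty (S n)]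
    (t : ∀ n, S (n + 1) → S n) : ∃ s : ∀ n, S n, ∀ n, t n (s (n + 1)) = s n := by
  let F : ℕᵒᵖ ⥤ Type u := Functor.ofOpSequence (fun n => ↾(t n))
  have : ∀ n, Finite (F.obj n) := fun n => inferInstanceAs (Finite (S n.unop))
  have : ∀ n, Nonempty (F.obj n) := fun n => inferInstanceAs (Nonempty (S n.unop))
  obtain ⟨s, hs⟩ := nonempty_sections_of_finite_cofiltered_system F
  refine ⟨fun n => s (op n), fun n => ?_⟩
  have := hs (homOfLE (Nat.le_succ n)).op
  rw [Functor.ofOpSequence_map_homOfLE_succ] at this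
  exact this

/-- Final subsets are nonempty because cones exist at every level. Truncating a member of `S (n +
1)` gives a cone below some member of `S n`; these choices are the transition maps for König's
lemma. -/
lemma WeakSolvability.nonempty_cone_of_isCompactModule (hM : IsFlatModule M)
    (hcompact : IsCompactModule M) (h : WeakSolvability M) {J : Type} [SmallCategory J]
    [FinCategory J] [Nonempty J] (D : J ⥤ Complex M) : Nonempty (Cone D) := by
  choose S hfin hfinal using fun n => hcompact n J D
  have : ∀ n, Finite (S n) := hfin
  have : ∀ n, Nonempty (S n) := fun n => by
    obtain ⟨x⟩ := h.nonempty_cone hM n D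
    obtain ⟨s, hs, -⟩ := hfinal n x
    exact ⟨s, hs⟩
  choose t ht hle using fun n (s : S (n + 1)) => hfinal n (truncCone D n s.1)
  obtain ⟨s, hs⟩ := exists_coherent_sequence (S := fun n => S n) (fun n s => ⟨t n s, ht n s⟩)
  refine nonempty_cone_of_sequence D (fun n => (s n).1) fun n => ?_
  exact (congrArg (fun x => truncCone D n (s (n + 1)).1 ≤ x) (congrArg Subtype.val (hs n))).mp
    (hle n (s (n + 1)))

/-- The canonical arrow `a ⇸ a` of a pointed module. -/
def point (c : idModule A ⟶ M) (a : A) : Broken M a a := (c.app (op a)).app a (𝟙 a)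

/-- Together with `actL_point`, this says that the point commutes with every morphism, which is what
makes `pointMap` natural. -/
lemma actR_point (c : idModule A ⟶ M) {a b : A} (f : a ⟶ b) :
    actR M f (point c a) = (c.app (op a)).app b f :=
  ((c.app (op a)).naturality_apply f (𝟙 a)).symm.trans
    (congrArg ((c.app (op a)).app b) (Category.id_comp f))

lemma actL_point (c : idModule A ⟶ M) {a b : A} (f : a ⟶ b) :
    actL M (point c b) f = (c.app (op a)).app b f :=
  (ConcreteCategory.congr_hom (NatTrans.congr_app (c.naturality f.op) b) (𝟙 b)).symm.trans
    (congrArg (fun g : a ⟶ b => (c.app (op a)).app b g) (Category.comp_id f))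

/-- The constant complex on an object. -/
def constComplex (c : idModule A ⟶ M) (a : A) : Complex M := ⟨fun _ => a, fun _ => point c a⟩

theorem strongSolvability_of_weakSolvability (hM : IsFlatModule M) (c : idModule A ⟶ M)
    (hcompact : IsCompactModule M) (h : WeakSolvability M) : StrongSolvability M := by
  refine IsCofiltered.of_cone_nonempty.{0} _ fun {J} _ _ D => ?_
  -- Compactness says nothing about the empty diagram. There, weak solvability provides an object of
  -- `A`, and the point turns it into a constant complex.
  cases isEmpty_or_nonempty J with
  | inl _ =>
    obtain ⟨s⟩ := h J D
    exact ⟨{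
      pt := constComplex c (s.pt.obj 0)
      π := { app := isEmptyElim, naturality := isEmptyElim } }⟩
  | inr _ => exact h.nonempty_cone_of_isCompactModule hM hcompact D

/-! ### Filtered colimits of flat functors -/

/-- The identity of `a` is an initial object of the category of elements. -/
lemma isFlat_coyoneda (a : Aᵒᵖ) : IsFlat (coyoneda.obj a) := by
  let x : (coyoneda.obj a).Elements := (coyoneda.obj a).elementsMk a.unop (𝟙 _)
  refine IsCofiltered.of_isInitial (X := x) _ (IsInitial.ofUniqueHom (fun y => ⟨y.2, ?_⟩) ?_)
  · exact Category.id_comp (X := a.unop) y.2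
  · intro y m
    exact Subtype.ext ((Category.id_comp (X := a.unop) m.1).symm.trans m.2)

/-- Finitely many elements of a filtered colimit live at one stage, and an equality between them
already holds at a later stage; the cones are found there and pushed forward. -/
lemma isFlat_of_isColimit {J : Type u} [SmallCategory J] [IsFiltered J] {F : J ⥤ A ⥤ Type u}
    {t : Cocone F} (ht : IsColimit t) (hF : ∀ j, IsFlat (F.obj j)) : IsFlat t.pt := by
  have hFc : ∀ j, IsCofiltered (F.obj j).Elements := hF
  have ht' : ∀ a : A, IsColimit (((evaluation A (Type u)).obj a).mapCocone t) :=
    fun a => isColimitOfPreserves _ ht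
  have surj : ∀ (a : A) (x : t.pt.obj a), ∃ (j : J) (y : (F.obj j).obj a),
      (t.ι.app j).app a y = x := fun a x => Types.jointly_surjective _ (ht' a) x
  have eq_iff : ∀ {a : A} {j : J} (x y : (F.obj j).obj a),
      (t.ι.app j).app a x = (t.ι.app j).app a y →
      ∃ (k : J) (f : j ⟶ k), (F.map f).app a x = (F.map f).app a y := by
    intro a j x y h
    obtain ⟨k, f, g, hfg⟩ := (Types.FilteredColimit.isColimit_eq_iff _ (ht' a)).1 h
    -- The two elements become equal along different maps `f` and `g`; coequalizing these gives a
    -- single transition map.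
    refine ⟨IsFiltered.coeq f g, f ≫ IsFiltered.coeqHom f g, ?_⟩
    have h1 : F.map (f ≫ IsFiltered.coeqHom f g) = F.map f ≫ F.map (IsFiltered.coeqHom f g) :=
      F.map_comp _ _
    have h2 : F.map (f ≫ IsFiltered.coeqHom f g) = F.map g ≫ F.map (IsFiltered.coeqHom f g) := by
      rw [IsFiltered.coeq_condition, F.map_comp]
    have e1 := ConcreteCategory.congr_hom (NatTrans.congr_app h1 a) x
    have e2 := ConcreteCategory.congr_hom (NatTrans.congr_app h2 a) y
    exact (e1.trans (congrArg ((F.map (IsFiltered.coeqHom f g)).app a) hfg)).trans e2.symm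
  have glue : ∀ {a : A} {j k : J} (f : j ⟶ k) (x : (F.obj j).obj a),
      (t.ι.app k).app a ((F.map f).app a x) = (t.ι.app j).app a x := fun {a} _ _ f x =>
    ConcreteCategory.congr_hom (NatTrans.congr_app (t.w f) a) x
  have hne : Nonempty t.pt.Elements := by
    obtain ⟨j⟩ := IsFiltered.nonempty (C := J)
    obtain ⟨⟨a, x⟩⟩ := (hFc j).nonempty
    exact ⟨⟨a, (t.ι.app j).app a x⟩⟩
  refine @IsCofiltered.mk _ _ ⟨?_, ?_⟩ hne
  · rintro ⟨a, x⟩ ⟨b, y⟩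
    obtain ⟨j, x, rfl⟩ := surj a x
    obtain ⟨k, y, rfl⟩ := surj b y
    obtain ⟨⟨d, z⟩, f, g, -⟩ := (hFc (IsFiltered.max j k)).cone_objs
      ⟨a, (F.map (IsFiltered.leftToMax j k)).app a x⟩
      ⟨b, (F.map (IsFiltered.rightToMax j k)).app b y⟩
    let φ := NatTrans.mapElements (t.ι.app (IsFiltered.max j k))
    exact ⟨⟨d, (t.ι.app _).app d z⟩, ⟨f.1, (φ.map f).2.trans (glue _ x)⟩,
      ⟨g.1, (φ.map g).2.trans (glue _ y)⟩, trivial⟩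
  · rintro ⟨a, x⟩ ⟨b, y⟩ ⟨p, hp⟩ ⟨q, hq⟩
    obtain ⟨j, x, rfl⟩ := surj a x
    have hpq : (t.ι.app j).app b ((F.obj j).map p x) = (t.ι.app j).app b ((F.obj j).map q x) :=
      ((((t.ι.app j).naturality_apply p x).trans hp).trans hq.symm).trans
        ((t.ι.app j).naturality_apply q x).symm
    obtain ⟨k, f, hf⟩ := eq_iff _ _ hpq
    have hf' : (F.obj k).map p ((F.map f).app a x) = (F.obj k).map q ((F.map f).app a x) :=
      (((F.map f).naturality_apply p x).symm.trans hf).trans ((F.map f).naturality_apply q x)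
    obtain ⟨⟨d, z⟩, r, hr⟩ := (hFc k).cone_maps
      (X := (F.obj k).elementsMk a ((F.map f).app a x))
      (Y := (F.obj k).elementsMk b ((F.obj k).map q ((F.map f).app a x))) ⟨p, hf'⟩ ⟨q, rfl⟩
    let φ := NatTrans.mapElements (t.ι.app k)
    exact ⟨⟨d, (t.ι.app k).app d z⟩, ⟨r.1, (φ.map r).2.trans (glue f x)⟩,
      Subtype.ext (show r.1 ≫ p = r.1 ≫ q from congrArg Subtype.val hr)⟩

theorem isFlat_colimit_of_strongSolvability (h : StrongSolvability M) :
    IsFlat (colimit (representables M)) := by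
  have : IsCofiltered (Complex M) := h
  exact isFlat_of_isColimit (colimit.isColimit (representables M)) fun _ => isFlat_coyoneda _

/-! ### Coalgebras from the point of the module -/

/-- For a pointed module, every functor `X` is a coalgebra, with `x` sent to the class of the point
and `x`. -/
def pointMap (c : idModule A ⟶ M) (X : A ⥤ Type u) : X ⟶ tensorObj M X where
  app a := ↾fun x => tmk M X (point c a) x
  naturality a b f := by
    ext x
    refine (tmk_glue M X f (point c b) x).symm.trans ?_
    exact congrArg (tmk M X · x) ((actL_point c f).trans (actR_point c f).symm)

lemma pointMap_naturality (c : idModule A ⟶ M) {X Y : A ⥤ Type u} (h : X ⟶ Y) :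
    pointMap c X ≫ tensorMap M h = h ≫ pointMap c Y := rfl

/-- Every flat functor, regarded as a coalgebra. -/
def pointCoalgebra (hM : IsFlatModule M) (c : idModule A ⟶ M) :
    Flat A ⥤ Endofunctor.Coalgebra (tensorFlat M hM) where
  obj X := ⟨X, ObjectProperty.homMk (pointMap c X.obj)⟩
  map h := ⟨h, ObjectProperty.hom_ext _ (pointMap_naturality c h.hom)⟩
  map_id _ := rfl
  map_comp _ _ := rfl

/-- The representable functors, regarded as flat functors. -/
def flatCoyoneda (A : Type u) [SmallCategory A] : Aᵒᵖ ⥤ Flat A :=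
  ObjectProperty.lift _ coyoneda isFlat_coyoneda

lemma isCofiltered_of_hasFinalCoalgebra (hM : IsFlatModule M) (c : idModule A ⟶ M)
    (h : HasFinalCoalgebra (tensorFlat M hM)) : IsCofiltered A := by
  obtain ⟨T, ⟨hT⟩⟩ := h
  let τ : ∀ a : A, coyoneda.obj (op a) ⟶ T.V.obj := fun a =>
    (hT.from ((flatCoyoneda A ⋙ pointCoalgebra hM c).obj (op a))).f.hom
  have hτ : ∀ {a b : A} (f : a ⟶ b), coyoneda.map f.op ≫ τ a = τ b := fun {a b} f =>
    congrArg (fun h => h.f.hom)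
      (hT.hom_ext ((flatCoyoneda A ⋙ pointCoalgebra hM c).map f.op ≫ hT.from _) (hT.from _))
  -- By Yoneda, the cocone `τ` amounts to a compatible choice of an element of `T` over every
  -- object.
  let G : A ⥤ T.V.obj.Elements :=
    { obj := fun a => ⟨a, (τ a).app a (𝟙 a)⟩
      map := fun {a b} f => ⟨f, by
        refine ((τ a).naturality_apply f (𝟙 a)).symm.trans ?_
        refine Eq.trans ?_ (ConcreteCategory.congr_hom (NatTrans.congr_app (hτ f) b) (𝟙 b))
        exact congrArg (fun g : a ⟶ b => (τ a).app b g)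
          ((Category.id_comp f).trans (Category.comp_id f).symm)⟩
      map_id := fun _ => rfl
      map_comp := fun _ _ => rfl }
  have : IsCofiltered T.V.obj.Elements := T.V.property
  refine IsCofiltered.of_cone_nonempty.{0} _ fun {J} _ _ D => ?_
  obtain ⟨s⟩ := IsCofiltered.cone_nonempty (D ⋙ G)
  exact ⟨(CategoryOfElements.π _).mapCone s⟩

lemma weakSolvability_of_isCofiltered [IsCofiltered A] : WeakSolvability M := by
  intro J _ _ D
  obtain ⟨s⟩ := IsCofiltered.cone_nonempty (D ⋙ prHead M)
  refine ⟨{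
    pt := ⟨fun _ => s.pt, Fin.elim0⟩
    π := {
      app := fun j =>
        { app := fun i => Fin.cases (motive := fun i => s.pt ⟶ ((D ⋙ pr M 0).obj j).obj i)
            (s.π.app j) (fun i => i.elim0) i
          comm := fun i => i.elim0 }
      naturality := fun j k f => ?_ } }⟩
  apply TruncComplex.Hom.ext
  funext i
  exact Fin.cases (s.π.naturality f) (fun i => i.elim0) i

/-! ### Resolutions -/

/-- A complex with elements `xₙ` of `X` such that the structure map `e` of a coalgebra sends `xₙ`
to `mₙ₊₁ ⊗ xₙ₊₁`. -/
structure Resolution {X : A ⥤ Type u} (e : X ⟶ tensorObj M X) where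
  complex : Complex M
  pts : ∀ n, X.obj (complex.obj n)
  app_pts : ∀ n, e.app _ (pts n) = tmk M X (complex.arr n) (pts (n + 1))

namespace Resolution

variable {X Y : A ⥤ Type u} {e : X ⟶ tensorObj M X} {e' : Y ⟶ tensorObj M Y}

lemma exists_step (e : X ⟶ tensorObj M X) (p : X.Elements) :
    ∃ (q : X.Elements) (m : Broken M q.1 p.1), e.app _ p.2 = tmk M X m q.2 := by
  obtain ⟨⟨b, m, x⟩, h⟩ := Quot.exists_rep (e.app p.1 p.2)
  exact ⟨⟨b, x⟩, m, h.symm⟩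

/-- A resolution of an element of a coalgebra. -/
def of (e : X ⟶ tensorObj M X) (p : X.Elements) : Resolution e :=
  let next := fun q => (exists_step e q).choose
  let seq : ℕ → X.Elements := fun n => Nat.rec p (fun _ q => next q) n
  { complex := ⟨fun n => (seq n).1, fun n => (exists_step e (seq n)).choose_spec.choose⟩
    pts := fun n => (seq n).2
    app_pts := fun n => (exists_step e (seq n)).choose_spec.choose_spec }

/-- The resolution of `x₁` obtained from one of `x₀`. -/
def tail (r : Resolution e) : Resolution e :=
  ⟨r.complex.tail, fun n => r.pts (n + 1), fun n => r.app_pts (n + 1)⟩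

/-- Coalgebra morphisms preserve resolutions. -/
def map (r : Resolution e) (h : X ⟶ Y) (hh : e ≫ tensorMap M h = h ≫ e') : Resolution e' where
  complex := r.complex
  pts n := h.app _ (r.pts n)
  app_pts n :=
    (ConcreteCategory.congr_hom (NatTrans.congr_app hh _) (r.pts n)).symm.trans
      (congrArg ((tensorMap M h).app _) (r.app_pts n))

/-- Write `e z = p ⊗ w`. Naturality of `e` makes both `(g @ p) ⊗ w` and `(g' @ p) ⊗ w` agree with
the next steps of the resolutions. Each equality is witnessed by a span, and flatness of `X` merges
the two spans over `w`. -/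
lemma exists_span_step (hX : IsFlat X) (r r' : Resolution e) (n : ℕ) {d : A} (z : X.obj d)
    (g : d ⟶ r.complex.obj n) (g' : d ⟶ r'.complex.obj n)
    (hg : X.map g z = r.pts n) (hg' : X.map g' z = r'.pts n) :
    ∃ (d₁ : A) (z₁ : X.obj d₁) (g₁ : d₁ ⟶ r.complex.obj (n + 1))
      (g₁' : d₁ ⟶ r'.complex.obj (n + 1)) (p : Broken M d₁ d),
      X.map g₁ z₁ = r.pts (n + 1) ∧ X.map g₁' z₁ = r'.pts (n + 1) ∧
      actL M (r.complex.arr n) g₁ = actR M g p ∧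
      actL M (r'.complex.arr n) g₁' = actR M g' p := by
  have hXc : IsCofiltered X.Elements := hX
  obtain ⟨⟨b, w⟩, p, hp⟩ := exists_step e ⟨d, z⟩
  have key : ∀ (s : Resolution e) (k : d ⟶ s.complex.obj n), X.map k z = s.pts n →
      tmk M X (actR M k p) w = tmk M X (s.complex.arr n) (s.pts (n + 1)) := fun s k hk =>
    (congrArg ((tensorObj M X).map k) hp).symm.trans
      ((e.naturality_apply k z).symm.trans ((congrArg (e.app _) hk).trans (s.app_pts n)))
  obtain ⟨u, y, s, t, hs, ht, hst⟩ := exists_span_of_tmk_eq M hX (key r g hg)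
  obtain ⟨u', y', s', t', hs', ht', hst'⟩ := exists_span_of_tmk_eq M hX (key r' g' hg')
  obtain ⟨⟨v, x⟩, ⟨k, hk⟩, ⟨k', hk'⟩, hkk⟩ := IsCofiltered.cospan
    (CategoryOfElements.homMk (X.elementsMk u y) (X.elementsMk b w) s hs)
    (CategoryOfElements.homMk (X.elementsMk u' y') (X.elementsMk b w) s' hs')
  have hkk : k ≫ s = k' ≫ s' := congrArg Subtype.val hkk
  have hk : X.map k x = y := hk
  have hk' : X.map k' x = y' := hk'
  refine ⟨v, x, k ≫ t, k' ≫ t', actL M p (k ≫ s), ?_, ?_, ?_, ?_⟩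
  · rw [Functor.map_comp_apply, hk, ht]
  · rw [Functor.map_comp_apply, hk', ht']
  · rw [actL_comp, ← hst, actR_actL, actL_comp]
  · rw [actL_comp, ← hst', hkk, actR_actL, actL_comp]

/-- Two resolutions of the same element of a flat coalgebra are connected by a span. -/
lemma exists_span (hX : IsFlat X) (r r' : Resolution e) {a : A} (f : r.complex.obj 0 ⟶ a)
    (f' : r'.complex.obj 0 ⟶ a) (h : X.map f (r.pts 0) = X.map f' (r'.pts 0)) :
    ∃ (d : Complex M) (g : d ⟶ r.complex) (g' : d ⟶ r'.complex),
      g.app 0 ≫ f = g'.app 0 ≫ f' := by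
  have hXc : IsCofiltered X.Elements := hX
  let State : ℕ → Type u := fun n => { s : Σ d : A, X.obj d × (d ⟶ r.complex.obj n) ×
    (d ⟶ r'.complex.obj n) //
    X.map s.2.2.1 s.2.1 = r.pts n ∧ X.map s.2.2.2 s.2.1 = r'.pts n }
  have step : ∀ n (s : State n), ∃ (t : State (n + 1)) (p : Broken M t.1.1 s.1.1),
      actL M (r.complex.arr n) t.1.2.2.1 = actR M s.1.2.2.1 p ∧
      actL M (r'.complex.arr n) t.1.2.2.2 = actR M s.1.2.2.2 p := fun n s => by
    obtain ⟨d, z, g, g', p, h1, h2, h3⟩ :=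
      exists_span_step hX r r' n s.1.2.1 s.1.2.2.1 s.1.2.2.2 s.2.1 s.2.2
    exact ⟨⟨⟨d, z, g, g'⟩, h1, h2⟩, p, h3⟩
  -- Only the initial state involves `f` and `f'`: it is chosen so that the two legs agree in `a`.
  obtain ⟨⟨d, z⟩, ⟨g, hg⟩, ⟨g', hg'⟩, hgg⟩ := IsCofiltered.cospan
    (CategoryOfElements.homMk (X.elementsMk _ (r.pts 0)) (X.elementsMk a (X.map f (r.pts 0))) f rfl)
    (CategoryOfElements.homMk (X.elementsMk _ (r'.pts 0)) (X.elementsMk a (X.map f (r.pts 0))) f'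
      h.symm)
  choose next arr h1 h2 using step
  let seq : ∀ n, State n := fun n => Nat.rec ⟨⟨d, z, g, g'⟩, hg, hg'⟩ next n
  exact ⟨⟨fun n => (seq n).1.1, fun n => arr n (seq n)⟩,
    ⟨fun n => (seq n).1.2.2.1, fun n => h1 n (seq n)⟩,
    ⟨fun n => (seq n).1.2.2.2, fun n => h2 n (seq n)⟩, congrArg Subtype.val hgg⟩

end Resolution

/-! ### The colimit of representables as a coalgebra -/

/-- The colimit of the representables indexed by complexes. -/
abbrev complexColimit (M : CatModule A) : A ⥤ Type u := colimit (representables M)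

/-- The class of a complex `c` and a morphism `f : c₀ ⟶ a`. -/
def cls (c : Complex M) {a : A} (f : c.obj 0 ⟶ a) : (complexColimit M).obj a :=
  (colimit.ι (representables M) (op c)).app a f

lemma map_cls (c : Complex M) {a b : A} (f : c.obj 0 ⟶ a) (g : a ⟶ b) :
    (complexColimit M).map g (cls c f) = cls c (f ≫ g) :=
  ((colimit.ι (representables M) (op c)).naturality_apply g f).symm

lemma cls_comp {c c' : Complex M} (h : c' ⟶ c) {a : A} (f : c.obj 0 ⟶ a) :
    cls c' (h.app 0 ≫ f) = cls c f :=
  ConcreteCategory.congr_hom (NatTrans.congr_app (colimit.w (representables M) h.op) a) f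

lemma exists_cls_eq {a : A} (x : (complexColimit M).obj a) :
    ∃ (c : Complex M) (f : c.obj 0 ⟶ a), cls c f = x := by
  obtain ⟨c, f, h⟩ := Types.jointly_surjective _
    (isColimitOfPreserves ((evaluation A (Type u)).obj a)
      (colimit.isColimit (representables M))) x
  exact ⟨c.unop, f, h⟩

/-- The cocone defining the coalgebra structure on the colimit. -/
def complexColimitCocone (M : CatModule A) : Cocone (representables M) where
  pt := tensorObj M (complexColimit M)
  ι :=
    { app := fun c =>
        { app := fun a => ↾fun f : c.unop.obj 0 ⟶ a =>
            tmk M (complexColimit M) (actR M f (c.unop.arr 0)) (cls c.unop.tail (𝟙 _))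
          naturality := fun a b g => by
            ext f
            exact congrArg (tmk M (complexColimit M) · _) (actR_comp M f g _) }
      naturality := fun c c' h => by
        ext a f
        let g : c.unop.obj 0 ⟶ a := f
        have h1 : actR M (h.unop.app 0 ≫ g) (c'.unop.arr 0) =
            actL M (actR M g (c.unop.arr 0)) (h.unop.app 1) := by
          rw [actR_comp, ← h.unop.comm 0, actR_actL]
        refine (congrArg (tmk M (complexColimit M) · _) h1).trans ?_
        refine (tmk_glue M (complexColimit M) (h.unop.app 1) _ _).trans ?_
        refine congrArg (tmk M (complexColimit M) (actR M g (c.unop.arr 0))) ?_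
        refine (map_cls _ _ _).trans ?_
        refine Eq.trans ?_ (cls_comp ((Complex.tailFunctor M).map h.unop) (𝟙 _))
        exact congrArg (cls c'.unop.tail)
          ((Category.id_comp _).trans (Category.comp_id (h.unop.app 1)).symm) }

/-- The coalgebra structure on the colimit, sending the class of a complex to the tensor product of
its last arrow and the class of its tail. -/
def complexColimitStr (M : CatModule A) :
    complexColimit M ⟶ tensorObj M (complexColimit M) :=
  colimit.desc (representables M) (complexColimitCocone M)

lemma complexColimitStr_cls (c : Complex M) {a : A} (f : c.obj 0 ⟶ a) :
    (complexColimitStr M).app a (cls c f) =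
      tmk M (complexColimit M) (actR M f (c.arr 0)) (cls c.tail (𝟙 _)) :=
  ConcreteCategory.congr_hom (NatTrans.congr_app
    (colimit.ι_desc (complexColimitCocone M) (op c)) a) f

namespace Complex

/-- Reindexing of a complex along a shift. -/
def reindex (c : Complex M) (φ : ℕ → ℕ) (hφ : ∀ k, φ (k + 1) = φ k + 1) : Complex M where
  obj k := c.obj (φ k)
  arr k := (hφ k).symm ▸ c.arr (φ k)

/-- Indices such as `0 + k` and `k` are not definitionally equal; comparing whole index functions
lets one substitution transport objects and arrows together. -/
lemma cls_reindex_heq (c : Complex M) {φ ψ : ℕ → ℕ} (hφ : ∀ k, φ (k + 1) = φ k + 1)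
    (hψ : ∀ k, ψ (k + 1) = ψ k + 1) (h : φ = ψ) :
    HEq (cls (c.reindex φ hφ) (𝟙 _)) (cls (c.reindex ψ hψ) (𝟙 _)) := by
  subst h
  rfl

/-- The complex consisting of the arrows from the `n`-th one on. -/
def drop (c : Complex M) (n : ℕ) : Complex M := c.reindex (fun k => n + k) fun _ => rfl

lemma cls_drop_zero (c : Complex M) : cls (c.drop 0) (𝟙 (c.obj 0)) = cls c (𝟙 (c.obj 0)) :=
  eq_of_heq (cls_reindex_heq c (φ := fun k => 0 + k) (ψ := id) (fun _ => rfl) (fun _ => rfl)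
    (funext Nat.zero_add))

lemma cls_drop_succ (c : Complex M) (n : ℕ) :
    cls (c.drop (n + 1)) (𝟙 (c.obj (n + 1))) = cls (c.drop n).tail (𝟙 (c.obj (n + 1))) :=
  eq_of_heq (cls_reindex_heq c (φ := fun k => n + 1 + k) (ψ := fun k => n + (k + 1))
    (fun _ => rfl) (fun _ => rfl) (by funext k; omega))

end Complex

/-- The resolution of the class of a complex by the classes of its tails. -/
def Complex.resolution (c : Complex M) : Resolution (complexColimitStr M) where
  complex := c
  pts n := cls (c.drop n) (𝟙 (c.obj n))
  app_pts n := by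
    refine (complexColimitStr_cls (c.drop n) (𝟙 _)).trans ?_
    refine (congrArg (tmk M (complexColimit M) · _) (actR_id M ((c.drop n).arr 0))).trans ?_
    exact congrArg (tmk M (complexColimit M) (c.arr n)) (c.cls_drop_succ n).symm

section Final

variable {X : A ⥤ Type u} {e : X ⟶ tensorObj M X}

lemma Resolution.cls_eq (hX : IsFlat X) (r r' : Resolution e) {a : A} (f : r.complex.obj 0 ⟶ a)
    (f' : r'.complex.obj 0 ⟶ a) (h : X.map f (r.pts 0) = X.map f' (r'.pts 0)) :
    cls r.complex f = cls r'.complex f' := by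
  obtain ⟨d, g, g', hd⟩ := Resolution.exists_span hX r r' f f' h
  rw [← cls_comp g, ← cls_comp g', hd]

/-- The class of a resolution of an element of the colimit is that element. -/
lemma Resolution.cls_complex (hI : IsFlat (complexColimit M))
    (r : Resolution (complexColimitStr M)) {a : A} (f : r.complex.obj 0 ⟶ a) :
    cls r.complex f = (complexColimit M).map f (r.pts 0) := by
  obtain ⟨c, f', h⟩ := exists_cls_eq ((complexColimit M).map f (r.pts 0))
  rw [← h]
  -- A representing complex `c` comes with its own resolution by tails, and flatness of the colimit
  -- allows comparing it with `r`.
  refine Resolution.cls_eq hI r c.resolution f f' (h.symm.trans ?_)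
  refine Eq.trans ?_ (congrArg ((complexColimit M).map f') c.cls_drop_zero.symm)
  refine Eq.trans ?_ (map_cls c (𝟙 _) f').symm
  rw [Category.id_comp]

/-- The morphism to the colimit sending an element of a flat coalgebra to the class of its
resolutions. -/
def behaviour (hX : IsFlat X) (e : X ⟶ tensorObj M X) : X ⟶ complexColimit M where
  app a := ↾fun x => cls (Resolution.of e ⟨a, x⟩).complex (𝟙 a)
  naturality a b f := by
    ext x
    refine Eq.trans ?_ (map_cls (Resolution.of e ⟨a, x⟩).complex (𝟙 a) f).symm
    refine Resolution.cls_eq hX (Resolution.of e ⟨b, X.map f x⟩) (Resolution.of e ⟨a, x⟩)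
      (𝟙 b) (𝟙 a ≫ f) ?_
    change X.map (𝟙 b) (X.map f x) = X.map (𝟙 a ≫ f) x
    rw [Category.id_comp, Functor.map_id_apply]

/-- Any resolution computes `behaviour`, not just the chosen one; hence the tail of a resolution may
be used in `behaviour_comm`. -/
lemma behaviour_app (hX : IsFlat X) (r : Resolution e) {a : A} (f : r.complex.obj 0 ⟶ a) :
    (behaviour hX e).app a (X.map f (r.pts 0)) = cls r.complex f :=
  Resolution.cls_eq hX (Resolution.of e ⟨a, X.map f (r.pts 0)⟩) r (𝟙 a) f
    (Functor.map_id_apply X _ (X.map f (r.pts 0)))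

lemma behaviour_app_pts (hX : IsFlat X) (r : Resolution e) :
    (behaviour hX e).app _ (r.pts 0) = cls r.complex (𝟙 _) :=
  (congrArg ((behaviour hX e).app _) (Functor.map_id_apply X _ (r.pts 0)).symm).trans
    (behaviour_app hX r (𝟙 _))

lemma behaviour_comm (hX : IsFlat X) :
    e ≫ tensorMap M (behaviour hX e) = behaviour hX e ≫ complexColimitStr M := by
  ext a x
  let r := Resolution.of e ⟨a, x⟩
  refine (congrArg ((tensorMap M (behaviour hX e)).app a) (r.app_pts 0)).trans ?_
  refine Eq.trans ?_ (complexColimitStr_cls r.complex (𝟙 a)).symm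
  refine Eq.trans ?_ (congrArg (tmk M (complexColimit M) · _) (actR_id M (r.complex.arr 0)).symm)
  exact congrArg (tmk M (complexColimit M) (r.complex.arr 0)) (behaviour_app_pts hX r.tail)

/-- A coalgebra morphism carries a resolution of `x` to one of `h x` with the same underlying
complex, whose class must be `h x`. -/
lemma eq_behaviour (hX : IsFlat X) (hI : IsFlat (complexColimit M)) (h : X ⟶ complexColimit M)
    (hh : e ≫ tensorMap M h = h ≫ complexColimitStr M) : h = behaviour hX e := by
  ext a x
  let r := Resolution.of e ⟨a, x⟩
  exact (Functor.map_id_apply (complexColimit M) _ (h.app a x)).symm.trans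
    (Resolution.cls_complex hI (r.map h hh) (𝟙 a)).symm

end Final

theorem hasFinalCoalgebra_of_isFlat_colimit (hM : IsFlatModule M)
    (hI : IsFlat (colimit (representables M))) : HasFinalCoalgebra (tensorFlat M hM) :=
  ⟨⟨⟨complexColimit M, hI⟩, ObjectProperty.homMk (complexColimitStr M)⟩,
    ⟨IsTerminal.ofUniqueHom
      (fun V => ⟨ObjectProperty.homMk (behaviour V.V.property V.str.hom),
        ObjectProperty.hom_ext _ (behaviour_comm V.V.property)⟩)
      (fun V h => Endofunctor.Coalgebra.ext (ObjectProperty.hom_ext _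
        (eq_behaviour V.V.property hI h.f.hom
          (congrArg (fun k => k.hom) h.h))))⟩⟩

end

end SelfSimilarity

theorem mainTheorem6 {A : Type u} [SmallCategory A] (M : SelfSimilarity.CatModule A)
    (hM : SelfSimilarity.IsFlatModule M)
    (c : SelfSimilarity.idModule A ⟶ M)
    (hcompact : SelfSimilarity.IsCompactModule M) :
    List.TFAE [
      SelfSimilarity.WeakSolvability M,
      SelfSimilarity.StrongSolvability M,
      SelfSimilarity.IsFlat (colimit (SelfSimilarity.representables M)),
      SelfSimilarity.HasFinalCoalgebra (SelfSimilarity.tensorFlat M hM)] := by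
  tfae_have 1 → 2 := SelfSimilarity.strongSolvability_of_weakSolvability hM c hcompact
  tfae_have 2 → 3 := SelfSimilarity.isFlat_colimit_of_strongSolvability
  tfae_have 3 → 4 := SelfSimilarity.hasFinalCoalgebra_of_isFlat_colimit hM
  tfae_have 4 → 1 := fun h =>
    have := SelfSimilarity.isCofiltered_of_hasFinalCoalgebra hM c h
    SelfSimilarity.weakSolvability_of_isCofiltered
  tfae_finish
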